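/- Let $d\in\mathbb{N}$, let $\Omega\subset\mathbb{R}^d$ be a bounded open set (in particular, any bounded Lipschitz domain is allowed), and let $T>0$. Let $H^1_0(\Omega)$ be the closure of $C_0^\infty(\Omega)$ in the norm $\|v\|_{H^1_0(\Omega)}^2=\|v\|_{L^2(\Omega)}^2+\|\nabla v\|_{L^2(\Omega)}^2$, let $H^{-1}(\Omega)$ be its dual with duality pairing $\langle\cdot,\cdot\rangle$, and let $(\cdot,\cdot)$ denote the inner products of $L^2(\Omega)$ and $L^2(\Omega;\mathbb{R}^d)$. With weak time derivatives, put $$Y(0,T)=\{v\in L^2(0,T;H^1_0(\Omega)) : v'\in L^2(0,T;L^2(\Omega)),\ v''\in L^2(0,T;H^{-1}(\Omega))\}.$$ For $\tau>0$, $u_\tau\in L^2(0,T;L^2(\Omega))$, $y_0\in H^1_0(\Omega)$ and $y_1\in L^2(\Omega)$, a weak solution of the Cattaneo equation $\tau y_\tau''+y_\tau'-\Delta y_\tau=u_\tau$ in $(0,T)\times\Omega$ with homogeneous Dirichlet boundary condition is a function $y_\tau\in Y(0,T)$ such that $$\int_0^T \tau\langle y_\tau'',v\rangle+(y_\tau',v)+(\nabla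 y_\tau,\nabla v)\,dt=\int_0^T(u_\tau,v)\,dt\qquad\text{for all } v\in L^2(0,T;H^1_0(\Omega)),$$ and such that $y_\tau(0)=y_0$ and $y_\tau'(0)=y_1$, where the initial values are those of the representatives of $y_\tau$ in $C([0,T];L^2(\Omega))$ and of $y_\tau'$ in $C([0,T];H^{-1}(\Omega))$. Then for every $\tau_0>0$ there is a constant $C>0$, depending only on $\Omega$, $T$ and $\tau_0$, such that for all $\tau\in(0,\tau_0]$ and all $u_\tau\in L^2(0,T;L^2(\Omega))$, $y_0\in H^1_0(\Omega)$, $y_1\in L^2(\Omega)$, every weak solution $y_\tau\in Y(0,T)$ satisfies $$\|y_\tau\|_{L^2(0,T;H^1_0(\Omega))}^2+\|y_\tau'\|_{L^2(0,T;L^2(\Omega))}^2\le C\left(\|u_\tau\|_{L^2(0,T;L^2(\Omega))}^2+\|y_0\|_{H^1_0(\Omega)}^2+\|y_1\|_{L^2(\Omega)}^2\right).$$ In particular, $C$ is independent of $\tau$ as $\tau\to0$. -/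

import Mathlib

open MeasureTheory Set Topology
open scoped ENNReal ContDiff

noncomputable section

namespace Cattaneo

/-- The Euclidean space `ℝ^d`. -/
abbrev Space (d : ℕ) : Type := EuclideanSpace ℝ (Fin d)

/-- The Lebesgue space `L²(Ω)`. -/
abbrev L2 {d : ℕ} (Ω : TopologicalSpace.Opens (Space d)) : Type :=
  Lp ℝ 2 ((volume : Measure (Space d)).restrict (Ω : Set (Space d)))

/-- The space `L²(Ω; ℝ^d)` of square integrable vector fields. -/
abbrev L2Vec {d : ℕ} (Ω : TopologicalSpace.Opens (Space d)) : Type :=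
  Lp (Space d) 2 ((volume : Measure (Space d)).restrict (Ω : Set (Space d)))

/-- The Hilbert space `L²(Ω) × L²(Ω; ℝ^d)` with `‖(v, g)‖² = ‖v‖² + ‖g‖²`. A function `v` of
`H¹(Ω)` is identified with the pair `(v, ∇v)` in this space; the norm of the pair is the `H¹`
norm of `v`. -/
abbrev FunGrad {d : ℕ} (Ω : TopologicalSpace.Opens (Space d)) : Type :=
  WithLp 2 (L2 Ω × L2Vec Ω)

/-- The subspace of all pairs `(φ, ∇φ)` with `φ ∈ C₀^∞(Ω)`. -/
def testFunGrad {d : ℕ} (Ω : TopologicalSpace.Opens (Space d)) : Submodule ℝ (FunGrad Ω) where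
  carrier := {p | ∃ φ : TestFunction Ω ℝ ⊤,
    (p.fst =ᵐ[(volume : Measure (Space d)).restrict (Ω : Set (Space d))] fun x => φ x) ∧
    (p.snd =ᵐ[(volume : Measure (Space d)).restrict (Ω : Set (Space d))] fun x => gradient φ x)}
  zero_mem' := by
    refine ⟨0, ?_, ?_⟩
    · filter_upwards [Lp.coeFn_zero ℝ 2
        ((volume : Measure (Space d)).restrict (Ω : Set (Space d)))] with x hx
      exact hx
    · filter_upwards [Lp.coeFn_zero (Space d) 2
        ((volume : Measure (Space d)).restrict (Ω : Set (Space d)))] with x hx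
      have e : gradient (0 : TestFunction Ω ℝ ⊤) x = 0 := by simp [gradient]
      exact hx.trans e.symm
  add_mem' := by
    rintro p q ⟨φ, hφ, hφ'⟩ ⟨ψ, hψ, hψ'⟩
    refine ⟨φ + ψ, ?_, ?_⟩
    · filter_upwards [Lp.coeFn_add p.fst q.fst, hφ, hψ] with x h h1 h2
      exact h.trans (congrArg₂ (· + ·) h1 h2)
    · filter_upwards [Lp.coeFn_add p.snd q.snd, hφ', hψ'] with x h h1 h2
      have d1 : DifferentiableAt ℝ φ x := φ.contDiff.differentiable (by simp) x
      have d2 : DifferentiableAt ℝ ψ x := ψ.contDiff.differentiable (by simp) x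
      have e : gradient (φ + ψ : TestFunction Ω ℝ ⊤) x = gradient φ x + gradient ψ x := by
        simp only [gradient, FunLike.coe_add]
        rw [fderiv_add d1 d2, map_add]
      exact h.trans ((congrArg₂ (· + ·) h1 h2).trans e.symm)
  smul_mem' := by
    rintro c p ⟨φ, hφ, hφ'⟩
    refine ⟨c • φ, ?_, ?_⟩
    · filter_upwards [Lp.coeFn_smul c p.fst, hφ] with x h h1
      exact h.trans (congrArg (c • ·) h1)
    · filter_upwards [Lp.coeFn_smul c p.snd, hφ'] with x h h1
      have d1 : DifferentiableAt ℝ φ x := φ.contDiff.differentiable (by simp) x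
      have e : gradient (c • φ : TestFunction Ω ℝ ⊤) x = c • gradient φ x := by
        simp only [gradient, FunLike.coe_smul]
        rw [fderiv_const_smul d1 c]
        simp
      exact h.trans ((congrArg (c • ·) h1).trans e.symm)

/-- The Sobolev space `H¹₀(Ω)`: the closure of `C₀^∞(Ω)` with respect to the `H¹` norm
`‖v‖² = ‖v‖²_{L²} + ‖∇v‖²_{L²}`. Its elements are represented as pairs `(v, ∇v)`. -/
def H10 {d : ℕ} (Ω : TopologicalSpace.Opens (Space d)) : Submodule ℝ (FunGrad Ω) :=
  (testFunGrad Ω).topologicalClosure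

/-- The dual space `H⁻¹(Ω)` of `H¹₀(Ω)`, with the operator norm. -/
abbrev Hneg1 {d : ℕ} (Ω : TopologicalSpace.Opens (Space d)) : Type :=
  H10 Ω →L[ℝ] ℝ

/-- The embedding `H¹₀(Ω) → L²(Ω)`. -/
def toL2 {d : ℕ} (Ω : TopologicalSpace.Opens (Space d)) : H10 Ω →L[ℝ] L2 Ω :=
  (WithLp.fstL 2 ℝ (L2 Ω) (L2Vec Ω)).comp (H10 Ω).subtypeL

/-- The weak gradient `H¹₀(Ω) → L²(Ω; ℝ^d)`. -/
def grad {d : ℕ} (Ω : TopologicalSpace.Opens (Space d)) : H10 Ω →L[ℝ] L2Vec Ω :=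
  (WithLp.sndL 2 ℝ (L2 Ω) (L2Vec Ω)).comp (H10 Ω).subtypeL

/-- The embedding `L²(Ω) → H⁻¹(Ω)`, `f ↦ (v ↦ (f, v)_{L²(Ω)})`. -/
def toHneg1 {d : ℕ} (Ω : TopologicalSpace.Opens (Space d)) (f : L2 Ω) : Hneg1 Ω :=
  (innerSL ℝ f).comp (toL2 Ω)

/-- The bilinear form `a[y, v] = (∇y, ∇v)_{L²(Ω)}`. -/
def a {d : ℕ} (Ω : TopologicalSpace.Opens (Space d)) (y v : H10 Ω) : ℝ :=
  inner ℝ (grad Ω y) (grad Ω v)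

/-- The Bochner space `L²(0, T; X)`. -/
abbrev L2Time (T : ℝ) (X : Type*) [NormedAddCommGroup X] : Type _ :=
  Lp X 2 ((volume : Measure ℝ).restrict (Ioo 0 T))

/-- The open time interval `(0, T)`. -/
def timeInterval (T : ℝ) : TopologicalSpace.Opens ℝ := ⟨Ioo 0 T, isOpen_Ioo⟩

/-- `w` is the `k`-th order weak time derivative of `y` on `(0, T)`; `y` and `w` are meant to be
integrable on `(0, T)`. -/
def IsWeakTimeDeriv {X : Type*} [NormedAddCommGroup X] [NormedSpace ℝ X]
    (T : ℝ) (k : ℕ) (y w : ℝ → X) : Prop :=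
  ∀ φ : TestFunction (timeInterval T) ℝ ⊤,
    ∫ t in Ioo 0 T, iteratedDeriv k φ t • y t = (-1 : ℝ) ^ k • ∫ t in Ioo 0 T, φ t • w t

/-- `f` agrees almost everywhere on `(0, T)` with a function in `C([0, T]; X)` whose value at
time `0` is `x₀`; that is, `f(0) = x₀`. -/
def HasInitialValue {X : Type*} [NormedAddCommGroup X]
    (T : ℝ) (f : ℝ → X) (x₀ : X) : Prop :=
  ∃ g : ℝ → X, ContinuousOn g (Icc 0 T) ∧
    (∀ᵐ t ∂((volume : Measure ℝ).restrict (Ioo 0 T)), f t = g t) ∧ g 0 = x₀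

/-- `y`, with weak time derivatives `y'` and `y''`, belongs to
`Y(0, T) = {v ∈ L²(0,T;H¹₀(Ω)) | v' ∈ L²(0,T;L²(Ω)), v'' ∈ L²(0,T;H⁻¹(Ω))}`. -/
structure IsInY {d : ℕ} (Ω : TopologicalSpace.Opens (Space d)) (T : ℝ)
    (y : L2Time T (H10 Ω)) (y' : L2Time T (L2 Ω)) (y'' : L2Time T (Hneg1 Ω)) : Prop where
  deriv_one : IsWeakTimeDeriv T 1 (fun t => toL2 Ω (y t)) y'
  deriv_two : IsWeakTimeDeriv T 2 (fun t => toHneg1 Ω (toL2 Ω (y t))) y''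

/-- `y ∈ Y(0, T)`, with weak time derivatives `y'` and `y''`, is a weak solution of the Cattaneo
equation `τ y'' + y' - Δy = u` in `(0, T) × Ω` with homogeneous Dirichlet boundary values and
initial values `y(0) = y₀` in `L²(Ω)` and `y'(0) = y₁` in `H⁻¹(Ω)`. -/
structure IsWeakSolution {d : ℕ} (Ω : TopologicalSpace.Opens (Space d)) (T τ : ℝ)
    (u : L2Time T (L2 Ω)) (y₀ : H10 Ω) (y₁ : L2 Ω)
    (y : L2Time T (H10 Ω)) (y' : L2Time T (L2 Ω)) (y'' : L2Time T (Hneg1 Ω)) : Prop where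
  mem_Y : IsInY Ω T y y' y''
  variational : ∀ v : L2Time T (H10 Ω),
    ∫ t in Ioo 0 T, (τ * y'' t (v t) + inner ℝ (y' t) (toL2 Ω (v t)) + a Ω (y t) (v t)) =
      ∫ t in Ioo 0 T, inner ℝ (u t) (toL2 Ω (v t))
  initial_value : HasInitialValue T (fun t => toL2 Ω (y t)) (toL2 Ω y₀)
  initial_deriv : HasInitialValue T (fun t => toHneg1 Ω (y' t)) (toHneg1 Ω y₁)

end Cattaneo

end

/-! Formally, testing the equation with `y'` bounds `τ‖y'‖² + ‖∇y‖²` and the integral of `‖y'‖²` by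
the data, with `τ` entering only through `τ‖y₁‖² ≤ τ₀‖y₁‖²`. The displacement is then recovered from
`y = y₀ + ∫ y'`, so no Gronwall argument is needed. The obstacle is that `y'` takes values in `L²`
only and is not an admissible test function.

The remedy is abstract. Let `j : V → H` be the contraction `H¹₀ → L²`. The gradient form is `⟨y, v⟩
- ⟨j y, j v⟩`, and Riesz representation turns the equation into `τ z + j* y' + y - j* j y = j* u` in
`V`, with `z` the weak derivative of `j* y'`. Put `K = j* j` and `N = ∑ i < n, (1 - K)^i`. Then `N
j* y'` lies in `V` and has the integrable derivative `N z`, so the energy computation is rigorous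
for `N j* j y`; the symmetry behind it survives because `N K = K N = 1 - (1 - K)^n`. The bounds do
not depend on `n`.

Finally `(1 - K)^n → 0` strongly on `(ker j)ᗮ`, and likewise for `j j*` on `(ker j*)ᗮ`. The values
of `y` and `y'` lie in these subspaces, so dominated convergence gives the estimate. The carrying
lemmas are `IsWeakTimeDeriv.ae_eq_primitive`, `tendsto_one_sub_pow`, `regularized_energy_balance`
and `energy_estimate_regularized`. -/

noncomputable section

namespace Cattaneo

/-! ### Absolutely continuous vector-valued functions and primitives. -/

section AbsolutelyContinuous

variable {E : Type*} [NormedAddCommGroup E]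

/-- A function whose increments are dominated by those of an absolutely continuous function is
absolutely continuous. -/
theorem absolutelyContinuousOnInterval_of_dist_le {X Y : Type*} [PseudoMetricSpace X]
    [PseudoMetricSpace Y] {f : ℝ → X} {g : ℝ → Y} {a b : ℝ} (M : ℝ)
    (hg : AbsolutelyContinuousOnInterval g a b)
    (h : ∀ s ∈ uIcc a b, ∀ t ∈ uIcc a b, dist (f s) (f t) ≤ M * dist (g s) (g t)) :
    AbsolutelyContinuousOnInterval f a b := by
  have hM := Filter.Tendsto.const_mul M hg
  rw [mul_zero] at hM
  refine squeeze_zero' (Filter.Eventually.of_forall fun _ =>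
    Finset.sum_nonneg fun _ _ => dist_nonneg) ?_ hM
  filter_upwards [Filter.mem_inf_of_right (Filter.mem_principal_self _)] with I hI
  rw [Finset.mul_sum]
  exact Finset.sum_le_sum fun i hi => h _ (hI.1 i hi).1 _ (hI.1 i hi).2

variable [NormedSpace ℝ E]

theorem absolutelyContinuousOnInterval_primitive {f : ℝ → E} {a b : ℝ}
    (hf : IntervalIntegrable f volume a b) (c : E) :
    AbsolutelyContinuousOnInterval (fun t => c + ∫ s in a..t, f s) a b := by
  refine absolutelyContinuousOnInterval_of_dist_le 1
    (hf.norm.absolutelyContinuousOnInterval_intervalIntegral (c := a) left_mem_uIcc) ?_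
  intro s hs t ht
  have hi : ∀ t ∈ uIcc a b, IntervalIntegrable f volume a t := fun t ht =>
    hf.mono_set (uIcc_subset_uIcc left_mem_uIcc ht)
  rw [one_mul, dist_add_left, dist_comm, dist_comm (∫ v in a..s, ‖f v‖), dist_eq_norm,
    intervalIntegral.integral_interval_sub_left (hi t ht) (hi s hs), Real.dist_eq,
    intervalIntegral.integral_interval_sub_left (hi t ht).norm (hi s hs).norm]
  exact intervalIntegral.norm_integral_le_abs_integral_norm

theorem continuousOn_primitive {f : ℝ → E} {a b : ℝ} (hf : IntervalIntegrable f volume a b)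
    (c : E) : ContinuousOn (fun t => c + ∫ s in a..t, f s) (uIcc a b) :=
  (absolutelyContinuousOnInterval_primitive hf c).continuousOn

variable [CompleteSpace E]

theorem ae_hasDerivAt_primitive {f : ℝ → E} {a b : ℝ}
    (hf : IntervalIntegrable f volume a b) (c : E) :
    ∀ᵐ t, t ∈ uIcc a b → HasDerivAt (fun t => c + ∫ s in a..t, f s) (f t) t := by
  filter_upwards [hf.ae_hasDerivAt_integral] with t ht hm
  exact (ht hm a left_mem_uIcc).const_add c

/-- The fundamental theorem of calculus for absolutely continuous vector-valued functions. -/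
theorem integral_eq_sub_of_ae_hasDerivAt {F f : ℝ → E} {a b : ℝ}
    (hF : AbsolutelyContinuousOnInterval F a b) (hf : IntervalIntegrable f volume a b)
    (hd : ∀ᵐ t, t ∈ uIcc a b → HasDerivAt F (f t) t) :
    ∫ t in a..b, f t = F b - F a := by
  -- `F` minus the primitive of `f` is absolutely continuous with derivative zero almost everywhere,
  -- hence constant.
  obtain ⟨c, hc⟩ := (hF.sub
      (absolutelyContinuousOnInterval_primitive hf 0)).const_of_ae_hasDerivAt_zero (by
    filter_upwards [hd, ae_hasDerivAt_primitive hf 0] with t h1 h2 hm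
    simpa using (h1 hm).sub (h2 hm))
  have ha := hc a left_mem_uIcc
  have hb := hc b right_mem_uIcc
  simp only [Pi.sub_apply, intervalIntegral.integral_same, zero_add, sub_zero] at ha hb
  rw [ha, ← hb]
  abel

end AbsolutelyContinuous

/-- The chain rule for the squared norm. A primitive is bounded on the interval, so its squared norm
is again absolutely continuous and the fundamental theorem applies. -/
theorem norm_sq_primitive {E : Type*} [NormedAddCommGroup E] [InnerProductSpace ℝ E]
    [CompleteSpace E] {f : ℝ → E} {a b : ℝ} (hf : IntervalIntegrable f volume a b) (c : E) :
    IntervalIntegrable (fun t => inner ℝ (c + ∫ s in a..t, f s) (f t)) volume a b ∧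
      ‖c + ∫ s in a..b, f s‖ ^ 2 - ‖c‖ ^ 2 =
        2 * ∫ t in a..b, inner ℝ (c + ∫ s in a..t, f s) (f t) := by
  have hP := absolutelyContinuousOnInterval_primitive hf c
  have hPc := hP.continuousOn
  obtain ⟨M, hM⟩ := hP.exists_bound
  have hint : IntervalIntegrable (fun t => inner ℝ (c + ∫ s in a..t, f s) (f t)) volume a b := by
    rw [intervalIntegrable_iff] at hf ⊢
    have hm := (hPc.mono uIoc_subset_uIcc).aestronglyMeasurable (μ := volume) measurableSet_uIoc
    refine (hf.norm.const_mul M).mono' (hm.inner hf.aestronglyMeasurable) ?_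
    filter_upwards [ae_restrict_mem measurableSet_uIoc] with t ht
    exact (norm_inner_le_norm _ _).trans
      (mul_le_mul_of_nonneg_right (hM t (uIoc_subset_uIcc ht)) (norm_nonneg _))
  refine ⟨hint, ?_⟩
  have hac : AbsolutelyContinuousOnInterval (fun t => ‖c + ∫ s in a..t, f s‖ ^ 2) a b := by
    refine absolutelyContinuousOnInterval_of_dist_le (M + M) hP fun s hs t ht => ?_
    rw [Real.dist_eq, sq_sub_sq, abs_mul, dist_eq_norm]
    refine mul_le_mul ?_ (abs_norm_sub_norm_le _ _) (abs_nonneg _) ?_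
    · rw [abs_of_nonneg (by positivity)]
      exact add_le_add (hM s hs) (hM t ht)
    · have := (norm_nonneg _).trans (hM s hs)
      linarith
  have := integral_eq_sub_of_ae_hasDerivAt hac (hint.const_mul 2) (by
    filter_upwards [ae_hasDerivAt_primitive hf c] with t ht hm
    exact (ht hm).norm_sq)
  rw [intervalIntegral.integral_const_mul] at this
  rw [this]
  simp

/-! ### Weak time derivatives and their continuous representatives. -/

section WeakDerivative

variable {X Y : Type*} [NormedAddCommGroup X] [NormedSpace ℝ X]
  [NormedAddCommGroup Y] [NormedSpace ℝ Y] {T : ℝ}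

theorem setIntegral_Ioo_eq (hT : 0 ≤ T) (f : ℝ → X) :
    ∫ t in Ioo 0 T, f t = ∫ t in (0 : ℝ)..T, f t := by
  rw [intervalIntegral.integral_of_le hT, integral_Ioc_eq_integral_Ioo]

theorem intervalIntegrable_of_integrableOn_Ioo {E : Type*} [NormedAddCommGroup E]
    (hT : 0 ≤ T) {f : ℝ → E} (hf : IntegrableOn f (Ioo 0 T)) : IntervalIntegrable f volume 0 T := by
  rw [intervalIntegrable_iff_integrableOn_Ioo_of_le hT]
  exact hf

theorem intervalIntegrable_left {E : Type*} [NormedAddCommGroup E] {f : ℝ → E}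
    (hf : IntervalIntegrable f volume 0 T) {t : ℝ} (ht : t ∈ Icc 0 T) : IntervalIntegrable f volume 0 t :=
  hf.mono_set (by
    rw [uIcc_of_le ht.1, uIcc_of_le (ht.1.trans ht.2)]
    exact Icc_subset_Icc_right ht.2)

theorem integrableOn_iteratedDeriv_smul (φ : TestFunction (timeInterval T) ℝ ⊤) (k : ℕ)
    {f : ℝ → X} (hf : IntegrableOn f (Ioo 0 T)) :
    IntegrableOn (fun t => iteratedDeriv k φ t • f t) (Ioo 0 T) := by
  have hc : Continuous (iteratedDeriv k φ) := φ.contDiff.continuous_iteratedDeriv k (by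
    exact_mod_cast le_top)
  obtain ⟨M, hM⟩ := isCompact_Icc.exists_bound_of_continuousOn (s := Icc 0 T) hc.continuousOn
  refine Integrable.bdd_smul hf M hc.aestronglyMeasurable ?_
  filter_upwards [ae_restrict_mem measurableSet_Ioo] with t ht
  exact hM t (Ioo_subset_Icc_self ht)

theorem IsWeakTimeDeriv.clm_comp [CompleteSpace X] [CompleteSpace Y] (S : X →L[ℝ] Y) {k : ℕ}
    {f g : ℝ → X} (hf : IntegrableOn f (Ioo 0 T)) (hg : IntegrableOn g (Ioo 0 T))
    (h : IsWeakTimeDeriv T k f g) :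
    IsWeakTimeDeriv T k (fun t => S (f t)) (fun t => S (g t)) := by
  intro φ
  have h0 := integrableOn_iteratedDeriv_smul φ 0 hg
  rw [iteratedDeriv_zero] at h0
  have := congrArg S (h φ)
  rw [map_smul, ← S.integral_comp_comm (integrableOn_iteratedDeriv_smul φ k hf),
    ← S.integral_comp_comm h0] at this
  simpa only [map_smul] using this

theorem HasInitialValue.clm_comp (S : X →L[ℝ] Y) {f : ℝ → X} {x : X}
    (h : HasInitialValue T f x) : HasInitialValue T (fun t => S (f t)) (S x) := by
  obtain ⟨g, hg, he, h0⟩ := h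
  refine ⟨fun t => S (g t), S.continuous.comp_continuousOn hg, ?_, by simp only [h0]⟩
  filter_upwards [he] with t ht
  rw [ht]

/-- The derivative of a test function, as a test function. -/
def derivTestFunction (φ : TestFunction (timeInterval T) ℝ ⊤) :
    TestFunction (timeInterval T) ℝ ⊤ where
  toFun := deriv φ
  contDiff' := (contDiff_infty_iff_deriv.1 φ.contDiff).2
  hasCompactSupport' := φ.hasCompactSupport.deriv
  tsupport_subset' := tsupport_deriv_subset.trans φ.tsupport_subset

theorem coe_derivTestFunction (φ : TestFunction (timeInterval T) ℝ ⊤) :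
    (derivTestFunction φ : ℝ → ℝ) = deriv φ := rfl

/-- A second weak derivative is the weak derivative of a first weak derivative. -/
theorem IsWeakTimeDeriv.of_two {f g z : ℝ → X} (h1 : IsWeakTimeDeriv T 1 f g)
    (h2 : IsWeakTimeDeriv T 2 f z) : IsWeakTimeDeriv T 1 g z := by
  intro φ
  have e1 := h1 (derivTestFunction φ)
  have e2 := h2 φ
  rw [coe_derivTestFunction, ← iteratedDeriv_succ'] at e1
  rw [e1] at e2
  rw [iteratedDeriv_one]
  simpa [neg_eq_iff_eq_neg] using e2

theorem ae_eq_zero_of_testFunction [CompleteSpace X] {f : ℝ → X} (hf : IntegrableOn f (Ioo 0 T))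
    (h : ∀ φ : TestFunction (timeInterval T) ℝ ⊤, ∫ t in Ioo 0 T, φ t • f t = 0) :
    ∀ᵐ t ∂(volume : Measure ℝ).restrict (Ioo 0 T), f t = 0 := by
  rw [ae_restrict_iff' measurableSet_Ioo]
  refine isOpen_Ioo.ae_eq_zero_of_integral_contDiff_smul_eq_zero hf.locallyIntegrableOn ?_
  intro g h1 h2 h3
  rw [← h ⟨g, h1, h2, h3⟩]
  symm
  refine setIntegral_eq_integral_of_forall_compl_eq_zero fun t ht => ?_
  have : t ∉ tsupport g := fun hh => ht (h3 hh)
  exact smul_eq_zero_of_left (image_eq_zero_of_notMem_tsupport this) _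

/-- A weak derivative of the zero function vanishes. -/
theorem IsWeakTimeDeriv.ae_eq_zero [CompleteSpace X] {k : ℕ} {f : ℝ → X}
    (hf : IntegrableOn f (Ioo 0 T)) (h : IsWeakTimeDeriv T k (fun _ => (0 : X)) f) :
    ∀ᵐ t ∂(volume : Measure ℝ).restrict (Ioo 0 T), f t = 0 := by
  refine ae_eq_zero_of_testFunction hf fun φ => ?_
  have := h φ
  simp only [smul_zero, integral_zero] at this
  exact (smul_eq_zero.1 this.symm).resolve_left (pow_ne_zero _ (by norm_num))

theorem testFunction_apply_left (φ : TestFunction (timeInterval T) ℝ ⊤) : φ 0 = 0 :=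
  image_eq_zero_of_notMem_tsupport fun h => lt_irrefl _ (φ.tsupport_subset h).1

theorem testFunction_apply_right (φ : TestFunction (timeInterval T) ℝ ⊤) : φ T = 0 :=
  image_eq_zero_of_notMem_tsupport fun h => lt_irrefl _ (φ.tsupport_subset h).2

variable [CompleteSpace X]

/-- Integration by parts: the product of the test function and the primitive is absolutely
continuous and vanishes at both endpoints. -/
theorem isWeakTimeDeriv_primitive (hT : 0 ≤ T) {g : ℝ → X} (hg : IntegrableOn g (Ioo 0 T))
    (c : X) : IsWeakTimeDeriv T 1 (fun t => c + ∫ s in (0 : ℝ)..t, g s) g := by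
  intro φ
  have hg' := intervalIntegrable_of_integrableOn_Ioo hT hg
  have hP := absolutelyContinuousOnInterval_primitive hg' c
  have hPi : IntegrableOn (fun t => c + ∫ s in (0 : ℝ)..t, g s) (Ioo 0 T) := by
    have := hP.continuousOn
    rw [uIcc_of_le hT] at this
    exact (this.integrableOn_Icc (μ := volume)).mono_set Ioo_subset_Icc_self
  have hφ : AbsolutelyContinuousOnInterval φ 0 T :=
    ContDiffOn.absolutelyContinuousOnInterval (φ.contDiff.of_le (by
      exact_mod_cast le_top)).contDiffOn
  have i1 := integrableOn_iteratedDeriv_smul φ 1 hPi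
  have i0 := integrableOn_iteratedDeriv_smul φ 0 hg
  rw [iteratedDeriv_zero] at i0
  rw [iteratedDeriv_one] at i1 ⊢
  have key := integral_eq_sub_of_ae_hasDerivAt (hφ.smul hP)
    (intervalIntegrable_of_integrableOn_Ioo hT (i0.add i1)) (by
      filter_upwards [ae_hasDerivAt_primitive hg' c] with t ht hm
      exact ((φ.contDiff.differentiable (by simp) t).hasDerivAt.smul (ht hm)))
  rw [← setIntegral_Ioo_eq hT, integral_add' i0 i1] at key
  simp only [Pi.smul_apply', testFunction_apply_left, testFunction_apply_right, zero_smul,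
    sub_zero] at key
  rw [pow_one, neg_one_smul, eq_neg_iff_add_eq_zero, add_comm]
  exact key

theorem exists_testFunction_integral_eq_one (hT : 0 < T) :
    ∃ θ : TestFunction (timeInterval T) ℝ ⊤, ∫ t in Ioo 0 T, θ t = 1 := by
  let b : ContDiffBump (T / 2) := ⟨T / 8, T / 4, by positivity, by linarith⟩
  have hs : tsupport (b.normed volume) ⊆ Ioo 0 T := by
    rw [b.tsupport_normed_eq, Real.closedBall_eq_Icc]
    intro t ht
    have e : b.rOut = T / 4 := rfl
    rw [e] at ht
    constructor <;> linarith [ht.1, ht.2]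
  refine ⟨⟨b.normed volume, b.contDiff_normed, b.hasCompactSupport_normed, hs⟩, ?_⟩
  refine Eq.trans ?_ (b.integral_normed (μ := volume))
  refine setIntegral_eq_integral_of_forall_compl_eq_zero fun t ht => ?_
  exact image_eq_zero_of_notMem_tsupport fun hh => ht (hs hh)

/-- A test function with vanishing integral is the derivative of a test function. -/
theorem exists_testFunction_deriv_eq (hT : 0 < T) (φ : TestFunction (timeInterval T) ℝ ⊤)
    (h0 : ∫ t in Ioo 0 T, φ t = 0) :
    ∃ ψ : TestFunction (timeInterval T) ℝ ⊤, deriv ψ = φ := by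
  set F : ℝ → ℝ := fun t => ∫ s in (0 : ℝ)..t, φ s with hF
  have hd : ∀ t, HasDerivAt F (φ t) t := fun t =>
    intervalIntegral.integral_hasDerivAt_right (φ.continuous.intervalIntegrable _ _)
      φ.continuous.stronglyMeasurable.stronglyMeasurableAtFilter φ.continuous.continuousAt
  have hdF : deriv F = φ := funext fun t => (hd t).deriv
  rw [setIntegral_Ioo_eq hT.le] at h0
  obtain ⟨K, hK⟩ : ∃ K, K = tsupport φ := ⟨_, rfl⟩
  have hKc : IsCompact K := hK ▸ φ.hasCompactSupport
  have hKs : K ⊆ Ioo 0 T := hK ▸ φ.tsupport_subset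
  obtain ⟨a, b, ha, hb, hKab⟩ : ∃ a b, 0 < a ∧ b < T ∧ K ⊆ Icc a b := by
    rcases K.eq_empty_or_nonempty with h | h
    · exact ⟨T / 2, T / 2, by linarith, by linarith, by simp [h]⟩
    · exact ⟨sInf K, sSup K, (hKs (hKc.sInf_mem h)).1, (hKs (hKc.sSup_mem h)).2,
        fun x hx => ⟨csInf_le hKc.bddBelow hx, le_csSup hKc.bddAbove hx⟩⟩
  have hz : ∀ t, t ∉ Icc a b → φ t = 0 := fun t ht =>
    image_eq_zero_of_notMem_tsupport fun hh => ht (hKab (hK ▸ hh))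
  have hsupp : Function.support F ⊆ Icc a b := by
    intro t ht
    by_contra hn
    apply ht
    rcases not_and_or.1 hn with h | h
    · refine intervalIntegral.integral_zero_ae (.of_forall fun s hs => hz s ?_)
      rintro ⟨h1, -⟩
      have := hs.2
      rcases le_total 0 t with h' | h'
      · rw [max_eq_right h'] at this; linarith
      · rw [max_eq_left h'] at this; linarith
    -- To the right of `b` the primitive has already reached the full integral of `φ`, which is
    -- zero.
    · rw [← h0]
      refine eq_of_sub_eq_zero ?_
      simp only [hF]
      rw [intervalIntegral.integral_interval_sub_left (φ.continuous.intervalIntegrable _ _)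
        (φ.continuous.intervalIntegrable _ _)]
      refine intervalIntegral.integral_zero_ae (.of_forall fun s hs => hz s ?_)
      rintro ⟨-, h1⟩
      have h2 := hs.1
      have : b < min T t := lt_min hb (not_le.1 h)
      linarith
  have hts : tsupport F ⊆ Icc a b := closure_minimal hsupp isClosed_Icc
  refine ⟨⟨F, ?_, ?_, ?_⟩, hdF⟩
  · exact contDiff_infty_iff_deriv.2 ⟨fun t => (hd t).differentiableAt, hdF ▸ φ.contDiff⟩
  · exact isCompact_Icc.of_isClosed_subset (isClosed_tsupport _) hts
  · exact hts.trans fun t ht => ⟨ha.trans_le ht.1, ht.2.trans_lt hb⟩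

/-- A function with vanishing weak derivative is constant. -/
theorem IsWeakTimeDeriv.ae_eq_const (hT : 0 < T) {f : ℝ → X} (hf : IntegrableOn f (Ioo 0 T))
    (h : IsWeakTimeDeriv T 1 f fun _ => (0 : X)) :
    ∃ c, ∀ᵐ t ∂(volume : Measure ℝ).restrict (Ioo 0 T), f t = c := by
  obtain ⟨θ, hθ⟩ := exists_testFunction_integral_eq_one hT
  set c := ∫ t in Ioo 0 T, θ t • f t with hc
  have ic : IntegrableOn (fun _ => c) (Ioo 0 T) := integrableOn_const (by simp)
  have i0 : ∀ (φ : TestFunction (timeInterval T) ℝ ⊤) (g : ℝ → X), IntegrableOn g (Ioo 0 T) →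
      IntegrableOn (fun t => φ t • g t) (Ioo 0 T) := fun φ g hg => by
    simpa using integrableOn_iteratedDeriv_smul φ 0 hg
  have ir : ∀ φ : TestFunction (timeInterval T) ℝ ⊤, IntegrableOn φ (Ioo 0 T) := fun φ =>
    (φ.continuous.integrableOn_Icc (a := 0) (b := T)).mono_set Ioo_subset_Icc_self
  refine ⟨c, ?_⟩
  have := ae_eq_zero_of_testFunction (hf.sub ic) fun φ => ?_
  · filter_upwards [this] with t ht
    exact sub_eq_zero.1 ht
  -- The du Bois-Reymond argument: `φ - m • θ` has integral zero, hence is the derivative of an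
  -- admissible test function.
  · set m := ∫ t in Ioo 0 T, φ t with hm
    have e : ∀ t, (φ - m • θ : TestFunction (timeInterval T) ℝ ⊤) t = φ t - m * θ t := fun t => rfl
    obtain ⟨ψ, hψ⟩ := exists_testFunction_deriv_eq hT (φ - m • θ) (by
      simp only [e]
      rw [integral_sub (ir φ) ((ir θ).const_mul m), integral_const_mul, hθ, mul_one, sub_self])
    have h2 := h ψ
    rw [iteratedDeriv_one, hψ] at h2
    simp only [e, sub_smul, mul_smul, smul_zero, integral_zero] at h2
    have im : Integrable (fun t => m • θ t • f t) (volume.restrict (Ioo 0 T)) :=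
      Integrable.smul m (i0 θ f hf)
    rw [integral_sub (i0 φ f hf) im, integral_smul, ← hc] at h2
    simp only [Pi.sub_apply, smul_sub]
    rw [integral_sub (i0 φ f hf) (i0 φ _ ic), integral_smul_const, ← hm]
    exact h2

/-- A function with an integrable weak derivative and a prescribed initial value is the primitive
of its weak derivative. -/
theorem IsWeakTimeDeriv.ae_eq_primitive (hT : 0 < T) {f g : ℝ → X} {x : X}
    (hf : IntegrableOn f (Ioo 0 T)) (hg : IntegrableOn g (Ioo 0 T))
    (h : IsWeakTimeDeriv T 1 f g) (hx : HasInitialValue T f x) :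
    ∀ᵐ t ∂(volume : Measure ℝ).restrict (Ioo 0 T), f t = x + ∫ s in (0 : ℝ)..t, g s := by
  have hg' := intervalIntegrable_of_integrableOn_Ioo hT.le hg
  have hP := continuousOn_primitive hg' 0
  rw [uIcc_of_le hT.le] at hP
  have hPi := (hP.integrableOn_Icc (μ := volume)).mono_set (Ioo_subset_Icc_self)
  have hsub : IsWeakTimeDeriv T 1 (fun t => f t - (0 + ∫ s in (0 : ℝ)..t, g s))
      fun _ => (0 : X) := by
    intro φ
    simp only [smul_sub, smul_zero, integral_zero]
    rw [integral_sub (integrableOn_iteratedDeriv_smul φ 1 hf)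
      (integrableOn_iteratedDeriv_smul φ 1 hPi), h φ, isWeakTimeDeriv_primitive hT.le hg 0 φ,
      sub_self]
  obtain ⟨c, hc⟩ := hsub.ae_eq_const hT (hf.sub hPi)
  obtain ⟨r, hr, her, hr0⟩ := hx
  have hPc := continuousOn_primitive hg' c
  rw [uIcc_of_le hT.le] at hPc
  have hfc : ∀ᵐ t ∂(volume : Measure ℝ).restrict (Ioo 0 T), f t = c + ∫ s in (0 : ℝ)..t, g s := by
    filter_upwards [hc] with t ht
    rw [← ht, Pi.sub_apply]
    abel
  -- Two continuous representatives agree on all of `[0, T]`; at time zero this identifies `c` with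
  -- `x`.
  have heq := Measure.eqOn_Icc_of_ae_eq volume hT.ne (f := r)
    (g := fun t => c + ∫ s in (0 : ℝ)..t, g s) (by
      rw [← restrict_Ioo_eq_restrict_Icc]
      filter_upwards [hfc, her] with t h1 h2
      rw [← h1, ← h2]) hr hPc
  have h0 := heq (left_mem_Icc.2 hT.le)
  simp only [hr0, intervalIntegral.integral_same, add_zero] at h0
  rw [h0]
  exact hfc

end WeakDerivative

open ContinuousLinearMap

/-! ### Strong convergence of the powers of `1 - K`. -/

section Contraction

theorem pow_succ_apply {E : Type*} [NormedAddCommGroup E] [NormedSpace ℝ E] (S : E →L[ℝ] E)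
    (n : ℕ) (x : E) : (S ^ (n + 1)) x = S ((S ^ n) x) := by
  rw [pow_succ']
  rfl

variable {E : Type*} [NormedAddCommGroup E] [InnerProductSpace ℝ E] {K : E →L[ℝ] E}

theorem norm_sq_sub_apply_add_le (hK : ∀ x, ‖K x‖ ^ 2 ≤ inner ℝ (K x) x) (x : E) :
    ‖(1 - K) x‖ ^ 2 + ‖K x‖ ^ 2 ≤ ‖x‖ ^ 2 := by
  have := norm_sub_sq_real x (K x)
  rw [real_inner_comm] at this
  rw [show (1 - K) x = x - K x from rfl, this]
  linarith [hK x]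

theorem norm_one_sub_pow_apply_le (hK : ∀ x, ‖K x‖ ^ 2 ≤ inner ℝ (K x) x) (n : ℕ) (x : E) :
    ‖((1 - K) ^ n) x‖ ≤ ‖x‖ := by
  induction n with
  | zero => simp
  | succ n ih =>
    rw [pow_succ_apply]
    refine (pow_le_pow_iff_left₀ (norm_nonneg _) (norm_nonneg _) two_ne_zero).1 ?_
    have h1 := norm_sq_sub_apply_add_le hK (((1 - K) ^ n) x)
    have h2 := pow_le_pow_left₀ (norm_nonneg _) ih 2
    nlinarith [sq_nonneg ‖K (((1 - K) ^ n) x)‖]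

/-- The squares `‖(1 - K)^n x‖²` decrease and are bounded below, so their successive differences
tend to zero; these dominate `‖K (1 - K)^n x‖²`. -/
theorem tendsto_apply_one_sub_pow (hK : ∀ x, ‖K x‖ ^ 2 ≤ inner ℝ (K x) x) (x : E) :
    Filter.Tendsto (fun n : ℕ => K (((1 - K) ^ n) x)) Filter.atTop (𝓝 0) := by
  have hstep : ∀ n : ℕ, ‖((1 - K) ^ (n + 1)) x‖ ^ 2 + ‖K (((1 - K) ^ n) x)‖ ^ 2 ≤
      ‖((1 - K) ^ n) x‖ ^ 2 := fun n => by
    rw [pow_succ_apply]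
    exact norm_sq_sub_apply_add_le hK _
  have hanti : Antitone fun n : ℕ => ‖((1 - K) ^ n) x‖ ^ 2 := antitone_nat_of_succ_le fun n => by
    have := hstep n
    nlinarith [sq_nonneg ‖K (((1 - K) ^ n) x)‖]
  have hlim := tendsto_atTop_ciInf hanti ⟨0, by rintro _ ⟨n, rfl⟩; positivity⟩
  have hdiff := hlim.sub (hlim.comp (Filter.tendsto_add_atTop_nat 1))
  rw [sub_self] at hdiff
  have hsq : Filter.Tendsto (fun n : ℕ => ‖K (((1 - K) ^ n) x)‖ ^ 2) Filter.atTop (𝓝 0) :=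
    squeeze_zero (fun n => by positivity)
      (fun n => by simpa using le_sub_iff_add_le'.2 (hstep n)) hdiff
  rw [tendsto_zero_iff_norm_tendsto_zero]
  simpa using hsq.sqrt

/-- The powers of `1 - K` tend to zero on the closure of the range of `K`. -/
theorem tendsto_one_sub_pow (hK : ∀ x, ‖K x‖ ^ 2 ≤ inner ℝ (K x) x) {x : E}
    (hx : x ∈ (K : E →ₗ[ℝ] E).range.topologicalClosure) :
    Filter.Tendsto (fun n : ℕ => ((1 - K) ^ n) x) Filter.atTop (𝓝 0) := by
  rw [Metric.tendsto_atTop]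
  intro ε hε
  obtain ⟨_, ⟨v, rfl⟩, hv⟩ := Metric.mem_closure_iff.1 hx (ε / 2) (by positivity)
  obtain ⟨N, hN⟩ := Metric.tendsto_atTop.1 (tendsto_apply_one_sub_pow hK v) (ε / 2) (by positivity)
  refine ⟨N, fun n hn => ?_⟩
  have h1 := hN n hn
  -- Commutation turns the decay of `K (1 - K)^n v` into decay of `(1 - K)^n` on the range of `K`;
  -- contractivity extends it to the closure.
  have hc : Commute ((1 - K) ^ n) K := ((Commute.one_left K).sub_left (Commute.refl K)).pow_left n
  have e : ((1 - K) ^ n) (K v) = K (((1 - K) ^ n) v) :=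
    congrArg (fun S : E →L[ℝ] E => S v) hc.eq
  rw [dist_zero_right, ← e] at h1
  rw [dist_zero_right]
  have h2 := norm_one_sub_pow_apply_le hK n (x - K v)
  rw [dist_eq_norm] at hv
  calc ‖((1 - K) ^ n) x‖ = ‖((1 - K) ^ n) (x - K v) + ((1 - K) ^ n) (K v)‖ := by
        rw [map_sub, sub_add_cancel]
    _ ≤ _ := norm_add_le _ _
    _ < ε := by
        have : ‖x - K v‖ < ε / 2 := hv
        linarith

end Contraction

/-! ### Regularization by Neumann sums of `j* j`. -/

section Regularization

variable {V H : Type*} [NormedAddCommGroup V] [InnerProductSpace ℝ V] [CompleteSpace V]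
  [NormedAddCommGroup H] [InnerProductSpace ℝ H] [CompleteSpace H]

theorem norm_adjoint_apply_le {j : V →L[ℝ] H} (hj : ∀ v, ‖j v‖ ≤ ‖v‖) (h : H) :
    ‖adjoint j h‖ ≤ ‖h‖ := by
  have h1 : ‖j‖ ≤ 1 := j.opNorm_le_bound zero_le_one (by simpa using hj)
  refine (le_opNorm _ _).trans ?_
  rw [LinearIsometryEquiv.norm_map]
  exact mul_le_of_le_one_left (norm_nonneg _) h1

theorem norm_sq_adjoint_comp_self_le {j : V →L[ℝ] H} (hj : ∀ v, ‖j v‖ ≤ ‖v‖) (v : V) :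
    ‖(adjoint j ∘L j) v‖ ^ 2 ≤ inner ℝ ((adjoint j ∘L j) v) v := by
  rw [comp_apply, adjoint_inner_left, real_inner_self_eq_norm_sq]
  exact pow_le_pow_left₀ (norm_nonneg _) (norm_adjoint_apply_le hj _) 2

/-- The partial sum of the Neumann series of `K = j* j`; `K` times it is `1 - (1 - K) ^ n`. -/
def neumannSum (j : V →L[ℝ] H) (n : ℕ) : V →L[ℝ] V :=
  ∑ i ∈ Finset.range n, (1 - adjoint j ∘L j) ^ i

theorem adjoint_comp_self_neumannSum (j : V →L[ℝ] H) (n : ℕ) (v : V) :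
    adjoint j (j (neumannSum j n v)) = v - ((1 - adjoint j ∘L j) ^ n) v := by
  have := mul_neg_geom_sum (1 - adjoint j ∘L j) n
  rw [sub_sub_cancel] at this
  exact congrArg (fun S : V →L[ℝ] V => S v) this

theorem neumannSum_adjoint_comp_self (j : V →L[ℝ] H) (n : ℕ) (v : V) :
    neumannSum j n (adjoint j (j v)) = v - ((1 - adjoint j ∘L j) ^ n) v := by
  have := geom_sum_mul_neg (1 - adjoint j ∘L j) n
  rw [sub_sub_cancel] at this
  exact congrArg (fun S : V →L[ℝ] V => S v) this

/-- The intertwining `(1 - j* j)^i j* = j* (1 - j j*)^i` makes the regularization on `H` an instance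
of the same theory with `j*` in place of `j`. -/
theorem neumannSum_adjoint (j : V →L[ℝ] H) (n : ℕ) (h : H) :
    neumannSum j n (adjoint j h) = adjoint j (neumannSum (adjoint j) n h) := by
  have hp : ∀ i : ℕ, ((1 - adjoint j ∘L j) ^ i) (adjoint j h) =
      adjoint j (((1 - adjoint (adjoint j) ∘L adjoint j) ^ i) h) := by
    intro i
    induction i with
    | zero => simp
    | succ i ih =>
      rw [pow_succ_apply, ih, pow_succ_apply]
      simp
  simp only [neumannSum, sum_apply, map_sum, hp]

theorem apply_neumannSum_adjoint (j : V →L[ℝ] H) (n : ℕ) (h : H) :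
    j (neumannSum j n (adjoint j h)) = h - ((1 - adjoint (adjoint j) ∘L adjoint j) ^ n) h := by
  rw [neumannSum_adjoint, ← adjoint_comp_self_neumannSum, adjoint_adjoint]

variable {j : V →L[ℝ] H}

theorem norm_neumannSum_adjoint_comp_self_le (hj : ∀ v, ‖j v‖ ≤ ‖v‖) (n : ℕ) (v : V) :
    ‖neumannSum j n (adjoint j (j v))‖ ≤ 2 * ‖v‖ := by
  rw [neumannSum_adjoint_comp_self, two_mul]
  exact (norm_sub_le _ _).trans (add_le_add_right
    (norm_one_sub_pow_apply_le (norm_sq_adjoint_comp_self_le hj) n v) _)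

theorem norm_apply_neumannSum_adjoint_le (hj : ∀ v, ‖j v‖ ≤ ‖v‖) (n : ℕ) (h : H) :
    ‖j (neumannSum j n (adjoint j h))‖ ≤ 2 * ‖h‖ := by
  rw [apply_neumannSum_adjoint, two_mul]
  exact (norm_sub_le _ _).trans (add_le_add_right
    (norm_one_sub_pow_apply_le (norm_sq_adjoint_comp_self_le (norm_adjoint_apply_le hj)) n h) _)

theorem tendsto_neumannSum_adjoint_comp_self (hj : ∀ v, ‖j v‖ ≤ ‖v‖) {v : V}
    (hv : v ∈ (j : V →ₗ[ℝ] H).kerᗮ) :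
    Filter.Tendsto (fun n => neumannSum j n (adjoint j (j v))) Filter.atTop (𝓝 v) := by
  -- `j` and the self-adjoint `j* j` have the same kernel, so its orthogonal complement is the
  -- closure of the range of `j* j`.
  rw [← ker_adjoint_comp_self, orthogonal_ker, adjoint_comp, adjoint_adjoint] at hv
  have := (tendsto_one_sub_pow (norm_sq_adjoint_comp_self_le hj) hv).const_sub v
  simpa only [neumannSum_adjoint_comp_self, sub_zero] using this

theorem tendsto_apply_neumannSum_adjoint (hj : ∀ v, ‖j v‖ ≤ ‖v‖) {h : H}
    (hh : h ∈ (adjoint j : H →ₗ[ℝ] V).kerᗮ) :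
    Filter.Tendsto (fun n => j (neumannSum j n (adjoint j h))) Filter.atTop (𝓝 h) := by
  rw [← ker_adjoint_comp_self, orthogonal_ker, adjoint_comp, adjoint_adjoint] at hh
  have := (tendsto_one_sub_pow
    (norm_sq_adjoint_comp_self_le (norm_adjoint_apply_le hj)) (x := h) (by simpa using hh)).const_sub h
  simpa only [apply_neumannSum_adjoint, sub_zero] using this

end Regularization

/-- Cauchy-Schwarz, obtained by integrating `(t f - I)² ≥ 0` with `I` the integral of `f`. -/
theorem sq_intervalIntegral_le {f : ℝ → ℝ} {t : ℝ} (ht : 0 ≤ t)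
    (hf : IntervalIntegrable f volume 0 t) (hf2 : IntervalIntegrable (fun s => f s ^ 2) volume 0 t) :
    (∫ s in (0 : ℝ)..t, f s) ^ 2 ≤ t * ∫ s in (0 : ℝ)..t, f s ^ 2 := by
  rcases ht.eq_or_lt with rfl | ht'
  · simp
  set I := ∫ s in (0 : ℝ)..t, f s with hI
  have h0 : 0 ≤ ∫ s in (0 : ℝ)..t, (t ^ 2 * f s ^ 2 - 2 * t * I * f s + I ^ 2) :=
    intervalIntegral.integral_nonneg ht fun s _ => by nlinarith [sq_nonneg (t * f s - I)]
  rw [intervalIntegral.integral_add ((hf2.const_mul _).sub (hf.const_mul _))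
    intervalIntegrable_const, intervalIntegral.integral_sub (hf2.const_mul _) (hf.const_mul _),
    intervalIntegral.integral_const_mul, intervalIntegral.integral_const_mul,
    intervalIntegral.integral_const, ← hI, sub_zero, smul_eq_mul] at h0
  have h1 : 0 ≤ t * (t * (∫ s in (0 : ℝ)..t, f s ^ 2) - I ^ 2) := by nlinarith
  linarith [nonneg_of_mul_nonneg_right h1 ht']

/-! ### The abstract energy estimate, for fixed `n` and in the limit. -/

section EnergyEstimate

variable {V H : Type*} [NormedAddCommGroup V] [InnerProductSpace ℝ V] [CompleteSpace V]
  [NormedAddCommGroup H] [InnerProductSpace ℝ H] [CompleteSpace H]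

/-- The algebraic identity behind the energy balance: the equation tested with the derivative of
the regularized solution. -/
theorem regularized_energy_balance (j : V →L[ℝ] H) (n : ℕ) {τ : ℝ} {y z : V} {u y' : H}
    (h : τ • z + adjoint j y' + y - adjoint j (j y) = adjoint j u) :
    τ * inner ℝ (j (neumannSum j n (adjoint j y'))) (j (neumannSum j n z)) +
        inner ℝ (neumannSum j n (adjoint j (j y))) (neumannSum j n (adjoint j y')) -
        inner ℝ (j (neumannSum j n (adjoint j (j y)))) (j (neumannSum j n (adjoint j y'))) =
      inner ℝ (j (neumannSum j n (adjoint j y'))) (j (neumannSum j n (adjoint j u))) -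
        ‖j (neumannSum j n (adjoint j y'))‖ ^ 2 := by
  have hz : τ • z = adjoint j u - adjoint j y' - y + adjoint j (j y) := by
    rw [← h]
    abel
  have e := congrArg (fun v => inner ℝ (j (neumannSum j n (adjoint j y'))) (j (neumannSum j n v))) hz
  simp only [map_smul, map_add, map_sub, inner_add_right, inner_sub_right,
    real_inner_smul_right] at e
  -- Moving `j` across produces `j* j N y = N j* j y`, so the elastic term is a true inner product
  -- in `V` of the regularized solution with its derivative.
  have hy : inner ℝ (j (neumannSum j n (adjoint j y'))) (j (neumannSum j n y)) =
      inner ℝ (neumannSum j n (adjoint j (j y))) (neumannSum j n (adjoint j y')) := by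
    rw [← adjoint_inner_right, adjoint_comp_self_neumannSum, neumannSum_adjoint_comp_self,
      real_inner_comm]
  rw [e, hy, real_inner_self_eq_norm_sq, real_inner_comm (j (neumannSum j n (adjoint j y')))
    (j (neumannSum j n (adjoint j (j y))))]
  ring

variable {j : V →L[ℝ] H} {T τ τ₀ : ℝ} {u y' : ℝ → H} {y z : ℝ → V} {y₀ : V} {y₁ : H}

/-- After regularization, velocity and displacement are honest primitives `p` and `w` in `V`, with
images `q` and `r` in `H`, so the formal computation is legitimate. The constant is independent of
`n` because the regularized data are at most twice the original ones. -/
theorem energy_estimate_regularized (hj : ∀ v, ‖j v‖ ≤ ‖v‖) (hT : 0 < T) (hτ : 0 ≤ τ)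
    (hle : τ ≤ τ₀)
    (hu : MemLp u 2 (volume.restrict (Ioo 0 T))) (hy : MemLp y 2 (volume.restrict (Ioo 0 T)))
    (hy' : MemLp y' 2 (volume.restrict (Ioo 0 T))) (hz : MemLp z 2 (volume.restrict (Ioo 0 T)))
    (hd : IsWeakTimeDeriv T 1 (fun t => j (y t)) y')
    (hd' : IsWeakTimeDeriv T 1 (fun t => adjoint j (y' t)) z)
    (h0 : HasInitialValue T (fun t => j (y t)) (j y₀))
    (h1 : HasInitialValue T (fun t => adjoint j (y' t)) (adjoint j y₁))
    (heq : ∀ᵐ t ∂(volume : Measure ℝ).restrict (Ioo 0 T),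
      τ • z t + adjoint j (y' t) + y t - adjoint j (j (y t)) = adjoint j (u t)) (n : ℕ) :
    (∫ t in Ioo 0 T, ‖neumannSum j n (adjoint j (j (y t)))‖ ^ 2) +
        ∫ t in Ioo 0 T, ‖j (neumannSum j n (adjoint j (y' t)))‖ ^ 2 ≤
      4 * (1 + τ₀) * (1 + 3 * T + 2 * T ^ 2) *
        ((∫ t in Ioo 0 T, ‖u t‖ ^ 2) + ‖y₀‖ ^ 2 + ‖y₁‖ ^ 2) := by
  set N := neumannSum j n with hN
  set S := adjoint j with hS
  have iy' := hy'.integrable one_le_two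
  have iz := hz.integrable one_le_two
  have iy := hy.integrable one_le_two
  have iu2 : IntegrableOn (fun t => ‖u t‖ ^ 2) (Ioo 0 T) := hu.integrable_norm_pow two_ne_zero
  -- the primitives representing the regularized solution and its derivative
  set p : ℝ → V := fun t => N (S y₁) + ∫ s in (0 : ℝ)..t, N (z s) with hp
  have hNz : IntervalIntegrable (fun s => N (z s)) volume 0 T :=
    intervalIntegrable_of_integrableOn_Ioo hT.le (N.integrable_comp iz)
  have hpae : ∀ᵐ t ∂(volume : Measure ℝ).restrict (Ioo 0 T), N (S (y' t)) = p t :=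
    (hd'.clm_comp N (S.integrable_comp iy') iz).ae_eq_primitive hT
      (N.integrable_comp (S.integrable_comp iy')) (N.integrable_comp iz) (h1.clm_comp N)
  have hpc : ContinuousOn p (Icc 0 T) := by
    have := continuousOn_primitive hNz (N (S y₁))
    rwa [uIcc_of_le hT.le] at this
  have hpi : IntervalIntegrable p volume 0 T := by
    refine ContinuousOn.intervalIntegrable ?_
    rwa [uIcc_of_le hT.le]
  set w : ℝ → V := fun t => N (S (j y₀)) + ∫ s in (0 : ℝ)..t, p s with hw
  have hwae : ∀ᵐ t ∂(volume : Measure ℝ).restrict (Ioo 0 T), N (S (j (y t))) = w t := by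
    have hcomp := (hd.clm_comp (N ∘L S) (j.integrable_comp iy) iy').ae_eq_primitive hT
      ((N ∘L S).integrable_comp (j.integrable_comp iy)) ((N ∘L S).integrable_comp iy')
      (h0.clm_comp (N ∘L S))
    filter_upwards [hcomp, ae_restrict_mem measurableSet_Ioo] with t ht htm
    refine ht.trans (congrArg (_ + ·) ?_)
    rw [intervalIntegral.integral_of_le htm.1.le, intervalIntegral.integral_of_le htm.1.le]
    refine integral_congr_ae (ae_restrict_of_ae_restrict_of_subset ?_ hpae)
    exact fun s hs => ⟨hs.1, hs.2.trans_lt htm.2⟩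
  -- their images in `H`
  set q : ℝ → H := fun t => j (N (S y₁)) + ∫ s in (0 : ℝ)..t, j (N (z s)) with hq
  have hjNz : IntervalIntegrable (fun s => j (N (z s))) volume 0 T :=
    intervalIntegrable_of_integrableOn_Ioo hT.le (j.integrable_comp (N.integrable_comp iz))
  have hqp : ∀ t ∈ Icc 0 T, j (p t) = q t := fun t ht => by
    simp only [hp, hq, map_add]
    rw [← j.intervalIntegral_comp_comm (intervalIntegrable_left hNz ht)]
  have hqc : ContinuousOn q (Icc 0 T) :=
    (j.continuous.comp_continuousOn hpc).congr fun t ht => (hqp t ht).symm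
  have hqi : IntervalIntegrable q volume 0 T := by
    refine ContinuousOn.intervalIntegrable ?_
    rwa [uIcc_of_le hT.le]
  have hqi2 : IntervalIntegrable (fun s => ‖q s‖ ^ 2) volume 0 T := by
    refine ContinuousOn.intervalIntegrable ?_
    rw [uIcc_of_le hT.le]
    exact hqc.norm.pow 2
  set r : ℝ → H := fun t => j (N (S (j y₀))) + ∫ s in (0 : ℝ)..t, q s with hr
  have hrw : ∀ t ∈ Icc 0 T, j (w t) = r t := fun t ht => by
    simp only [hw, hr, map_add]
    rw [← j.intervalIntegral_comp_comm (intervalIntegrable_left hpi ht)]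
    refine congrArg (_ + ·) (intervalIntegral.integral_congr fun s hs => ?_)
    rw [uIcc_of_le ht.1] at hs
    exact hqp s ⟨hs.1, hs.2.trans ht.2⟩
  have hsub : ∀ t ∈ Icc 0 T, uIcc 0 t ⊆ uIcc 0 T := fun t ht => by
    rw [uIcc_of_le ht.1, uIcc_of_le hT.le]
    exact Icc_subset_Icc_right ht.2
  -- bounds on the initial data
  have b0 : ‖N (S (j y₀))‖ ≤ 2 * ‖y₀‖ := norm_neumannSum_adjoint_comp_self_le hj n y₀
  have b1 : ‖j (N (S y₁))‖ ≤ 2 * ‖y₁‖ := norm_apply_neumannSum_adjoint_le hj n y₁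
  set U := ∫ t in Ioo 0 T, ‖u t‖ ^ 2 with hU
  have hU0 : 0 ≤ U := integral_nonneg fun t => by positivity
  set F := 4 * (1 + τ₀) * (U + ‖y₀‖ ^ 2 + ‖y₁‖ ^ 2) with hF
  have hτ₀ : 0 ≤ τ₀ := hτ.trans hle
  have hen : ∀ t ∈ Icc 0 T, τ * ‖q t‖ ^ 2 + ‖w t‖ ^ 2 - ‖r t‖ ^ 2 +
      ∫ s in (0 : ℝ)..t, ‖q s‖ ^ 2 ≤ F := by
    intro t ht
    obtain ⟨i1, e1⟩ := norm_sq_primitive (intervalIntegrable_left hjNz ht) (j (N (S y₁)))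
    obtain ⟨i2, e2⟩ := norm_sq_primitive (intervalIntegrable_left hpi ht) (N (S (j y₀)))
    obtain ⟨i3, e3⟩ := norm_sq_primitive (intervalIntegrable_left hqi ht) (j (N (S (j y₀))))
    have iq := intervalIntegrable_left hqi2 ht
    have iu := intervalIntegrable_left (intervalIntegrable_of_integrableOn_Ioo hT.le iu2) ht
    have hmono := intervalIntegral.integral_mono_ae_restrict ht.1
      ((((i1.const_mul τ).add i2).sub i3).const_mul 2) ((iu.const_mul 4).sub iq) (by
        have hIcc : ∀ᵐ s ∂(volume : Measure ℝ).restrict (Ioo 0 T),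
            2 * (τ * inner ℝ (q s) (j (N (z s))) + inner ℝ (w s) (p s) - inner ℝ (r s) (q s)) ≤
              4 * ‖u s‖ ^ 2 - ‖q s‖ ^ 2 := by
          filter_upwards [hpae, hwae, heq, ae_restrict_mem measurableSet_Ioo] with s hs1 hs2 hs3 hm
          have hm' := Ioo_subset_Icc_self hm
          have hb := regularized_energy_balance j n hs3
          rw [← hN, ← hS, hs1, hs2, hqp s hm', hrw s hm'] at hb
          rw [hb]
          have hbu : ‖j (N (S (u s)))‖ ≤ 2 * ‖u s‖ := norm_apply_neumannSum_adjoint_le hj n (u s)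
          have hcs := real_inner_le_norm (q s) (j (N (S (u s))))
          -- Young's inequality absorbs one of the two copies of `‖q‖²`; the factor 4 is the square
          -- of the regularization bound 2.
          nlinarith [sq_nonneg (‖q s‖ - ‖j (N (S (u s)))‖),
            pow_le_pow_left₀ (norm_nonneg _) hbu 2]
        rw [restrict_Ioo_eq_restrict_Icc] at hIcc
        exact ae_restrict_of_ae_restrict_of_subset (Icc_subset_Icc_right ht.2) hIcc)
    rw [intervalIntegral.integral_const_mul, intervalIntegral.integral_sub
      ((i1.const_mul τ).add i2) i3, intervalIntegral.integral_add (i1.const_mul τ) i2,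
      intervalIntegral.integral_const_mul, intervalIntegral.integral_sub (iu.const_mul 4) iq,
      intervalIntegral.integral_const_mul] at hmono
    have hUt : ∫ s in (0 : ℝ)..t, ‖u s‖ ^ 2 ≤ U := by
      rw [hU, setIntegral_Ioo_eq hT.le]
      exact intervalIntegral.integral_mono_interval le_rfl ht.1 ht.2
        (.of_forall fun s => by positivity) (intervalIntegrable_of_integrableOn_Ioo hT.le iu2)
    have hq1 : τ * ‖j (N (S y₁))‖ ^ 2 ≤ τ₀ * (2 * ‖y₁‖) ^ 2 :=
      mul_le_mul hle (pow_le_pow_left₀ (norm_nonneg _) b1 2) (by positivity) hτ₀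
    have hw0 := pow_le_pow_left₀ (norm_nonneg _) b0 2
    have f1 : 0 ≤ τ₀ * U := mul_nonneg hτ₀ hU0
    have f2 : 0 ≤ τ₀ * ‖y₀‖ ^ 2 := by positivity
    simp only [hF]
    change ‖q t‖ ^ 2 - _ = _ at e1
    change ‖w t‖ ^ 2 - _ = _ at e2
    change ‖r t‖ ^ 2 - _ = _ at e3
    have e1' := congrArg (τ * ·) e1
    nlinarith [sq_nonneg ‖j (N (S (j y₀)))‖, sq_nonneg ‖y₁‖]
  -- Since `j` is a contraction, the negative term `-‖r‖²` is compensated by `‖w‖²`, which leaves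
  -- the dissipation bounded by `F`.
  have hrle : ∀ t ∈ Icc 0 T, ‖r t‖ ^ 2 ≤ ‖w t‖ ^ 2 := fun t ht => by
    rw [← hrw t ht]
    exact pow_le_pow_left₀ (norm_nonneg _) (hj _) 2
  have hQT : ∫ s in (0 : ℝ)..T, ‖q s‖ ^ 2 ≤ F := by
    have hTm := right_mem_Icc.2 hT.le
    have := hen T hTm
    have := hrle T hTm
    have : 0 ≤ τ * ‖q T‖ ^ 2 := by positivity
    linarith
  -- The energy gives `‖w‖² ≤ F + ‖r‖²`. As `r` is a primitive of `q`, `‖r‖² ≤ 8‖y₀‖² + 2T F ≤ (2 +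
  -- 2T) F`.
  have hwle : ∀ t ∈ Icc 0 T, ‖w t‖ ^ 2 ≤ (3 + 2 * T) * F := by
    intro t ht
    have hQt : ∫ s in (0 : ℝ)..t, ‖q s‖ ^ 2 ≤ F :=
      (intervalIntegral.integral_mono_interval le_rfl ht.1 ht.2
        (.of_forall fun s => by positivity) hqi2).trans hQT
    have hQ0 : 0 ≤ ∫ s in (0 : ℝ)..t, ‖q s‖ ^ 2 :=
      intervalIntegral.integral_nonneg ht.1 fun s _ => by positivity
    have hcs := sq_intervalIntegral_le ht.1 (intervalIntegrable_left hqi ht).norm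
      (intervalIntegrable_left hqi2 ht)
    have hn : ‖r t‖ ≤ 2 * ‖y₀‖ + ∫ s in (0 : ℝ)..t, ‖q s‖ :=
      (norm_add_le _ _).trans (add_le_add ((hj _).trans b0)
        (intervalIntegral.norm_integral_le_integral_norm ht.1))
    have hn2 := pow_le_pow_left₀ (norm_nonneg _) hn 2
    have htF : t * (∫ s in (0 : ℝ)..t, ‖q s‖ ^ 2) ≤ T * F :=
      mul_le_mul ht.2 hQt hQ0 hT.le
    have hy0F : 4 * ‖y₀‖ ^ 2 ≤ F := by
      simp only [hF]
      have f1 : 0 ≤ τ₀ * U := mul_nonneg hτ₀ hU0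
      have f2 : 0 ≤ τ₀ * ‖y₀‖ ^ 2 := by positivity
      have f3 : 0 ≤ τ₀ * ‖y₁‖ ^ 2 := by positivity
      nlinarith [sq_nonneg ‖y₁‖]
    have hE := hen t ht
    have : 0 ≤ τ * ‖q t‖ ^ 2 := by positivity
    nlinarith [sq_nonneg (2 * ‖y₀‖ - ∫ s in (0 : ℝ)..t, ‖q s‖)]
  have hI1 : ∫ t in Ioo 0 T, ‖N (S (j (y t)))‖ ^ 2 ≤ T * ((3 + 2 * T) * F) := by
    have hmono : ∫ t in Ioo 0 T, ‖N (S (j (y t)))‖ ^ 2 ≤ ∫ _ in Ioo 0 T, (3 + 2 * T) * F := by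
      refine integral_mono_of_nonneg (.of_forall fun t => by positivity) (integrableOn_const (by simp)) ?_
      filter_upwards [hwae, ae_restrict_mem measurableSet_Ioo] with t ht hm
      simp only [ht]
      exact hwle t (Ioo_subset_Icc_self hm)
    refine hmono.trans_eq ?_
    rw [setIntegral_const, Measure.real, Real.volume_Ioo, sub_zero, ENNReal.toReal_ofReal hT.le,
      smul_eq_mul]
  have hI2 : ∫ t in Ioo 0 T, ‖j (N (S (y' t)))‖ ^ 2 ≤ F := by
    refine le_of_eq_of_le ?_ hQT
    rw [← setIntegral_Ioo_eq hT.le]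
    refine integral_congr_ae ?_
    filter_upwards [hpae, ae_restrict_mem measurableSet_Ioo] with t ht hm
    rw [ht, hqp t (Ioo_subset_Icc_self hm)]
  calc _ ≤ T * ((3 + 2 * T) * F) + F := add_le_add hI1 hI2
    _ = _ := by simp only [hF]; ring

/-- Only `y` and `y'` must converge under the regularization; the data need only be bounded, so `y₀`
and `y₁` need not be orthogonal to the kernels. -/
theorem energy_estimate (hj : ∀ v, ‖j v‖ ≤ ‖v‖) (hT : 0 < T) (hτ : 0 < τ) (hle : τ ≤ τ₀)
    (hu : MemLp u 2 (volume.restrict (Ioo 0 T))) (hy : MemLp y 2 (volume.restrict (Ioo 0 T)))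
    (hy' : MemLp y' 2 (volume.restrict (Ioo 0 T))) (hz : MemLp z 2 (volume.restrict (Ioo 0 T)))
    (hd : IsWeakTimeDeriv T 1 (fun t => j (y t)) y')
    (hd' : IsWeakTimeDeriv T 1 (fun t => adjoint j (y' t)) z)
    (h0 : HasInitialValue T (fun t => j (y t)) (j y₀))
    (h1 : HasInitialValue T (fun t => adjoint j (y' t)) (adjoint j y₁))
    (heq : ∀ᵐ t ∂(volume : Measure ℝ).restrict (Ioo 0 T),
      τ • z t + adjoint j (y' t) + y t - adjoint j (j (y t)) = adjoint j (u t)) :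
    (∫ t in Ioo 0 T, ‖y t‖ ^ 2) + ∫ t in Ioo 0 T, ‖y' t‖ ^ 2 ≤
      4 * (1 + τ₀) * (1 + 3 * T + 2 * T ^ 2) *
        ((∫ t in Ioo 0 T, ‖u t‖ ^ 2) + ‖y₀‖ ^ 2 + ‖y₁‖ ^ 2) := by
  have iy' := hy'.integrable one_le_two
  have iz := hz.integrable one_le_two
  have iy := hy.integrable one_le_two
  -- `y'` is orthogonal to the kernel of the adjoint, since it is a weak derivative of `j y`
  have hy'ker : ∀ᵐ t ∂(volume : Measure ℝ).restrict (Ioo 0 T),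
      y' t ∈ (adjoint j : H →ₗ[ℝ] V).kerᗮ := by
    have hc : IsClosed ((adjoint j : H →ₗ[ℝ] V).ker : Set H) := (adjoint j).isClosed_ker
    have : CompleteSpace (adjoint j : H →ₗ[ℝ] V).ker := hc.completeSpace_coe
    set Q : H →L[ℝ] H := (adjoint j : H →ₗ[ℝ] V).ker.starProjection with hQ
    have hQj : ∀ v, Q (j v) = 0 := fun v => by
      rw [hQ, Submodule.starProjection_apply_eq_zero_iff, Submodule.mem_orthogonal]
      intro x hx
      rw [← adjoint_inner_left, show adjoint j x = 0 from hx, inner_zero_left]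
    have hder := hd.clm_comp Q (j.integrable_comp iy) iy'
    simp only [hQj] at hder
    filter_upwards [hder.ae_eq_zero (Q.integrable_comp iy')] with t ht
    rwa [← Submodule.starProjection_apply_eq_zero_iff]
  -- The projection `P` onto `ker j` annihilates the range of `j*`, and also `z`, a weak derivative
  -- of `j* y'`. Applied to the equation it leaves `P y = 0`.
  have hyker : ∀ᵐ t ∂(volume : Measure ℝ).restrict (Ioo 0 T),
      y t ∈ (j : V →ₗ[ℝ] H).kerᗮ := by
    have hc : IsClosed ((j : V →ₗ[ℝ] H).ker : Set V) := j.isClosed_ker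
    have : CompleteSpace (j : V →ₗ[ℝ] H).ker := hc.completeSpace_coe
    set P : V →L[ℝ] V := (j : V →ₗ[ℝ] H).ker.starProjection with hP
    have hPj : ∀ h, P (adjoint j h) = 0 := fun h => by
      rw [hP, Submodule.starProjection_apply_eq_zero_iff, Submodule.mem_orthogonal]
      intro x hx
      rw [adjoint_inner_right, show j x = 0 from hx, inner_zero_left]
    have hder := hd'.clm_comp P ((adjoint j).integrable_comp iy') iz
    simp only [hPj] at hder
    filter_upwards [hder.ae_eq_zero (P.integrable_comp iz), heq] with t ht hs
    rw [← Submodule.starProjection_apply_eq_zero_iff, ← hP]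
    have := congrArg P hs
    simpa [hPj, ht] using this
  have l1 : Filter.Tendsto (fun n => ∫ t in Ioo 0 T, ‖neumannSum j n (adjoint j (j (y t)))‖ ^ 2)
      Filter.atTop (𝓝 (∫ t in Ioo 0 T, ‖y t‖ ^ 2)) := by
    refine tendsto_integral_of_dominated_convergence (fun t => (2 * ‖y t‖) ^ 2) (fun n => ?_) ?_
      (fun n => .of_forall fun t => ?_) ?_
    · exact ((neumannSum j n ∘L adjoint j ∘L j).continuous.comp_aestronglyMeasurable
        hy.aestronglyMeasurable).norm.pow 2
    · simpa only [mul_pow] using (hy.integrable_norm_pow two_ne_zero).const_mul (2 ^ 2)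
    · rw [norm_pow, norm_norm]
      exact pow_le_pow_left₀ (norm_nonneg _) (norm_neumannSum_adjoint_comp_self_le hj n _) 2
    · filter_upwards [hyker] with t ht
      exact (tendsto_neumannSum_adjoint_comp_self hj ht).norm.pow 2
  have l2 : Filter.Tendsto (fun n => ∫ t in Ioo 0 T, ‖j (neumannSum j n (adjoint j (y' t)))‖ ^ 2)
      Filter.atTop (𝓝 (∫ t in Ioo 0 T, ‖y' t‖ ^ 2)) := by
    refine tendsto_integral_of_dominated_convergence (fun t => (2 * ‖y' t‖) ^ 2) (fun n => ?_) ?_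
      (fun n => .of_forall fun t => ?_) ?_
    · exact ((j ∘L neumannSum j n ∘L adjoint j).continuous.comp_aestronglyMeasurable
        hy'.aestronglyMeasurable).norm.pow 2
    · simpa only [mul_pow] using (hy'.integrable_norm_pow two_ne_zero).const_mul (2 ^ 2)
    · rw [norm_pow, norm_norm]
      exact pow_le_pow_left₀ (norm_nonneg _) (norm_apply_neumannSum_adjoint_le hj n _) 2
    · filter_upwards [hy'ker] with t ht
      exact (tendsto_apply_neumannSum_adjoint hj ht).norm.pow 2
  exact le_of_tendsto' (l1.add l2) fun n =>
    energy_estimate_regularized hj hT hτ.le hle hu hy hy' hz hd hd' h0 h1 heq n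

end EnergyEstimate

theorem Lp_norm_sq_eq_integral {α E : Type*} [NormedAddCommGroup E] [InnerProductSpace ℝ E]
    [MeasurableSpace α] {μ : Measure α} (f : Lp E 2 μ) : ‖f‖ ^ 2 = ∫ t, ‖f t‖ ^ 2 ∂μ := by
  rw [← real_inner_self_eq_norm_sq, L2.inner_def]
  simp only [real_inner_self_eq_norm_sq]

/-! ### Riesz representation: from the variational problem to an equation in `V`. -/

section Riesz

/-- The Riesz representation of a real functional, as a continuous linear map. -/
def riesz (V : Type*) [NormedAddCommGroup V] [InnerProductSpace ℝ V] [CompleteSpace V] :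
    (V →L[ℝ] ℝ) →L[ℝ] V :=
  LinearMap.mkContinuous
    { toFun := (InnerProductSpace.toDual ℝ V).symm
      map_add' := map_add _
      map_smul' := fun c f => by simp } 1 (fun f => by simp)

variable {V H : Type*} [NormedAddCommGroup V] [InnerProductSpace ℝ V] [CompleteSpace V]
  [NormedAddCommGroup H] [InnerProductSpace ℝ H] [CompleteSpace H]

theorem inner_riesz (f : V →L[ℝ] ℝ) (v : V) : inner ℝ (riesz V f) v = f v :=
  InnerProductSpace.toDual_symm_apply

/-- Under Riesz representation the embedding of `H` into the dual of `V` becomes `j*`, so the second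
derivative and the initial velocity can be handled inside `V`. -/
theorem riesz_innerSL_comp (j : V →L[ℝ] H) (f : H) :
    riesz V ((innerSL ℝ f).comp j) = adjoint j f := by
  refine ext_inner_right ℝ fun v => ?_
  rw [inner_riesz, adjoint_inner_left]
  rfl

/-- The variational equation, as an equation in `V` at almost every time. -/
theorem ae_eq_of_variational {j : V →L[ℝ] H} {T τ : ℝ} {u y' : L2Time T H} {y : L2Time T V}
    {y'' : L2Time T (V →L[ℝ] ℝ)}
    (h : ∀ v : L2Time T V, ∫ t in Ioo 0 T, (τ * y'' t (v t) + inner ℝ (y' t) (j (v t)) +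
        (inner ℝ (y t) (v t) - inner ℝ (j (y t)) (j (v t)))) =
      ∫ t in Ioo 0 T, inner ℝ (u t) (j (v t))) :
    ∀ᵐ t ∂(volume : Measure ℝ).restrict (Ioo 0 T),
      τ • riesz V (y'' t) + adjoint j (y' t) + y t - adjoint j (j (y t)) = adjoint j (u t) := by
  have m1 : MemLp (fun t => τ • riesz V (y'' t) + adjoint j (y' t) + y t - adjoint j (j (y t))) 2
      ((volume : Measure ℝ).restrict (Ioo 0 T)) :=
    ((((comp_memLp (riesz V) y'').const_smul τ).add (comp_memLp (adjoint j) y')).add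
      (Lp.memLp y)).sub (comp_memLp (adjoint j ∘L j) y)
  have m2 : MemLp (fun t => adjoint j (u t)) 2 ((volume : Measure ℝ).restrict (Ioo 0 T)) :=
    comp_memLp (adjoint j) u
  have hint : ∀ v : L2Time T V, inner ℝ (m1.toLp _ - m2.toLp _) v = 0 := by
    intro v
    rw [inner_sub_left, sub_eq_zero, L2.inner_def, L2.inner_def]
    refine Eq.trans (integral_congr_ae ?_) ((h v).trans (integral_congr_ae ?_))
    · filter_upwards [m1.coeFn_toLp] with t ht
      rw [ht, inner_sub_left, inner_add_left, inner_add_left, real_inner_smul_left, inner_riesz,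
        adjoint_inner_left, adjoint_inner_left]
      ring
    · filter_upwards [m2.coeFn_toLp] with t ht
      rw [ht, adjoint_inner_left]
  -- The residual belongs to `L²(0, T; V)` and may itself be used as test function.
  have hz : m1.toLp _ = m2.toLp _ := sub_eq_zero.1 (inner_self_eq_zero.1 (hint _))
  exact (MemLp.toLp_eq_toLp_iff m1 m2).1 hz

/-- The energy estimate for weak solutions of the abstract Cattaneo equation with the bilinear form
`⟨y, v⟩_V - ⟨j y, j v⟩_H`. -/
theorem energy_estimate_of_variational {j : V →L[ℝ] H} (hj : ∀ v, ‖j v‖ ≤ ‖v‖) {T τ τ₀ : ℝ}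
    (hT : 0 < T) (hτ : 0 < τ) (hle : τ ≤ τ₀) {u y' : L2Time T H} {y : L2Time T V}
    {y'' : L2Time T (V →L[ℝ] ℝ)} {y₀ : V} {y₁ : H}
    (hd : IsWeakTimeDeriv T 1 (fun t => j (y t)) y')
    (hdd : IsWeakTimeDeriv T 2 (fun t => (innerSL ℝ (j (y t))).comp j) y'')
    (h : ∀ v : L2Time T V, ∫ t in Ioo 0 T, (τ * y'' t (v t) + inner ℝ (y' t) (j (v t)) +
        (inner ℝ (y t) (v t) - inner ℝ (j (y t)) (j (v t)))) =
      ∫ t in Ioo 0 T, inner ℝ (u t) (j (v t)))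
    (h0 : HasInitialValue T (fun t => j (y t)) (j y₀))
    (h1 : HasInitialValue T (fun t => (innerSL ℝ (y' t)).comp j) ((innerSL ℝ y₁).comp j)) :
    ‖y‖ ^ 2 + ‖y'‖ ^ 2 ≤ 4 * (1 + τ₀) * (1 + 3 * T + 2 * T ^ 2) *
      (‖u‖ ^ 2 + ‖y₀‖ ^ 2 + ‖y₁‖ ^ 2) := by
  have iy := (Lp.memLp y).integrable one_le_two
  have iy' := (Lp.memLp y').integrable one_le_two
  have iy'' := (Lp.memLp y'').integrable one_le_two
  have d1 := hd.clm_comp (adjoint j) (j.integrable_comp iy) iy'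
  have hc : Continuous fun x : V => (innerSL ℝ (j x)).comp j := by fun_prop
  have hmeas : IntegrableOn (fun t => (innerSL ℝ (j (y t))).comp j) (Ioo 0 T) := by
    refine (iy.norm.const_mul (‖j‖ * ‖j‖)).mono'
      (hc.comp_aestronglyMeasurable iy.aestronglyMeasurable) (.of_forall fun t => ?_)
    refine (opNorm_comp_le _ _).trans ?_
    rw [innerSL_apply_norm, mul_right_comm]
    exact mul_le_mul_of_nonneg_right (j.le_opNorm _) (norm_nonneg _)
  have d2 := hdd.clm_comp (riesz V) hmeas iy''
  have hi := h1.clm_comp (riesz V)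
  simp only [riesz_innerSL_comp] at d2 hi
  rw [Lp_norm_sq_eq_integral y, Lp_norm_sq_eq_integral y', Lp_norm_sq_eq_integral u]
  exact energy_estimate hj hT hτ hle (Lp.memLp u) (Lp.memLp y) (Lp.memLp y')
    (comp_memLp (riesz V) y'') hd (d1.of_two d2) h0 hi (ae_eq_of_variational h)

end Riesz

/-! ### The Sobolev space as an instance of the abstract setting. -/

section Sobolev

variable {d : ℕ} (Ω : TopologicalSpace.Opens (Space d))

instance completeSpace_H10 : CompleteSpace (H10 Ω) :=
  (Submodule.isClosed_topologicalClosure (testFunGrad Ω)).completeSpace_coe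

/-- Writing the form as a difference of inner products avoids coercivity of the gradient form, hence
any Poincaré inequality. -/
theorem a_eq_inner_sub (v w : H10 Ω) :
    a Ω v w = inner ℝ v w - inner ℝ (toL2 Ω v) (toL2 Ω w) :=
  eq_sub_of_add_eq' (WithLp.prod_inner_apply (v : FunGrad Ω) (w : FunGrad Ω)).symm

theorem norm_toL2_le (v : H10 Ω) : ‖toL2 Ω v‖ ≤ ‖v‖ :=
  WithLp.norm_fst_le _ (v : FunGrad Ω)

end Sobolev

end Cattaneo

end

theorem mainTheorem4 {d : ℕ} (Ω : TopologicalSpace.Opens (Cattaneo.Space d))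
    (hΩ : Bornology.IsBounded (Ω : Set (Cattaneo.Space d)))
    (T : ℝ) (hT : 0 < T) (τ₀ : ℝ) (hτ₀ : 0 < τ₀) :
    ∃ C : ℝ, 0 < C ∧
      ∀ τ : ℝ, 0 < τ → τ ≤ τ₀ →
      ∀ (u : Cattaneo.L2Time T (Cattaneo.L2 Ω)) (y₀ : Cattaneo.H10 Ω) (y₁ : Cattaneo.L2 Ω)
        (y : Cattaneo.L2Time T (Cattaneo.H10 Ω)) (y' : Cattaneo.L2Time T (Cattaneo.L2 Ω))
        (y'' : Cattaneo.L2Time T (Cattaneo.Hneg1 Ω)),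
        Cattaneo.IsWeakSolution Ω T τ u y₀ y₁ y y' y'' →
          ‖y‖ ^ 2 + ‖y'‖ ^ 2 ≤ C * (‖u‖ ^ 2 + ‖y₀‖ ^ 2 + ‖y₁‖ ^ 2) := by
  refine ⟨4 * (1 + τ₀) * (1 + 3 * T + 2 * T ^ 2), by positivity, ?_⟩
  intro τ hτ hle u y₀ y₁ y y' y'' h
  refine Cattaneo.energy_estimate_of_variational (Cattaneo.norm_toL2_le Ω) hT hτ hle
    h.mem_Y.deriv_one h.mem_Y.deriv_two (fun v => ?_) h.initial_value h.initial_deriv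
  simp only [← Cattaneo.a_eq_inner_sub]
  exact h.variational v
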